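/- Let $\mathbb G_1$ be the directed graph with vertex set $\mathbb Z^2$ in which the edges leaving a vertex $(v_1,v_2)$ are those to $(v_1,v_2+1)$ and $(v_1,v_2-1)$, together with the edge to $(v_1+1,v_2)$ if $v_2\ge 0$, and the edge to $(v_1-1,v_2)$ if $v_2<0$. Let $M=(M_i)_{i\ge 0}$ be the simple random walk on $\mathbb G_1$, that is, the Markov chain which at each step jumps to a uniformly chosen one of the three out-neighbours of its current position, and let $\mathbb P_0$ be its law when it starts at the origin $(0,0)$. Let $T_k$ be the time just after the $k$-th vertical step of $M$, that is, the first time at which $k$ vertical steps have been made. Then, as $n\to\infty$, $$\mathbb P_0\big(M_{T_{2n}}=(0,0)\big)\sim\frac{1}{2\sqrt{\pi}\,n^{3/2}},$$ i.e. the ratio of the two sides tends to $1$. -/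

import Mathlib

open MeasureTheory Filter Asymptotics

/-- The partially directed square lattice `𝔾₁` on `ℤ²`: from every vertex there are edges one unit
up and one unit down, and one horizontal edge, which points to the right on the closed upper half
plane and to the left on the open lower half plane. -/
def latticeG1 : Digraph (ℤ × ℤ) where
  Adj v w :=
    w = (v.1, v.2 + 1) ∨ w = (v.1, v.2 - 1) ∨
      (w = (v.1 + 1, v.2) ∧ 0 ≤ v.2) ∨ (w = (v.1 - 1, v.2) ∧ v.2 < 0)

open Classical in
/-- One-step transition probabilities of the simple random walk on a directed graph (all
out-degrees finite and nonzero): from `v`, jump to a uniformly chosen out-neighbour of `v`. -/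
noncomputable def srwStep {V : Type*} (G : Digraph V) (v w : V) : ℝ :=
  if G.Adj v w then ((Set.ncard {u : V | G.Adj v u} : ℝ))⁻¹ else 0

/-- Under the probability measure `P`, the process `M 0, M 1, M 2, …` is the simple random walk on
the directed graph `G` (with countable vertex set) started at `x`, that is, the Markov chain with
transition probabilities `srwStep G` and initial state `x`. The Markov property is written in the
product form
`P (M 0 = v 0, …, M (n+1) = v (n+1)) = P (M 0 = v 0, …, M n = v n) * srwStep G (v n) (v (n+1))`. -/
structure IsSimpleRandomWalk {V Ω : Type*} [MeasurableSpace V] [MeasurableSpace Ω]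
    (G : Digraph V) (x : V) (P : Measure Ω) (M : ℕ → Ω → V) : Prop where
  measurable : ∀ i, Measurable (M i)
  start : ∀ᵐ ω ∂P, M 0 ω = x
  markov : ∀ (n : ℕ) (v : ℕ → V),
    P.real {ω | ∀ i ≤ n + 1, M i ω = v i} =
      P.real {ω | ∀ i ≤ n, M i ω = v i} * srwStep G (v n) (v (n + 1))

/-- The number of vertical steps among the first `t` steps of a trajectory in `ℤ²`. -/
def verticalSteps (m : ℕ → ℤ × ℤ) (t : ℕ) : ℕ :=
  ((Finset.range t).filter fun i => (m (i + 1)).2 ≠ (m i).2).card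

/-- The time just after the `k`-th vertical step of a trajectory in `ℤ²`, i.e. the first time at
which `k` vertical steps have been made (`0` for `k = 0`, and `⊤` if there are fewer than `k`
vertical steps). -/
noncomputable def verticalTime (m : ℕ → ℤ × ℤ) (k : ℕ) : ℕ∞ :=
  ⨅ (t : ℕ) (_ : verticalSteps m t = k), (t : ℕ∞)

/-! The vertical steps form a simple random walk on ℤ, and before each of them the walk makes a
geometric number of horizontal steps in the direction of its row. A return at the `2n`-th vertical
step therefore means that the vertical path is a bridge and that the right and left steps are equal
in number. If `a` vertices of the bridge (the last excluded) lie in rows `≥ 0` and `b = 2n - a`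
below, this equality has probability `balance a b`, which is symmetric in `a` and `b`. Only the
symmetrized count of bridges by `a` matters (`coeff_pathSum_swap`).

That count has a closed form of Chung-Feller type (`pathSum_add_swap`): the bridges with `a`
vertices above and those with `b` above together number `C_n + f_a f_b`, where `C_n` is the Catalan
number and `f` counts first passages to `1`. Hence twice the return probability is `C_n / 4^n` times
the sum of `balance a b` over `a + b = 2n`, plus a correction (`two_mul_return_eq`).

The sum of balances is explicit and tends to `1` (`sum_balance`). In the correction, `f_a f_b / 4^n
≤ 1 / ((a+1)(b+1))`, while `balance` is exponentially small when `a` or `b` is below `n/4`; so it is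
`O(n⁻²)` and negligible (`tendsto_oddCorrection`). Stirling's formula gives `C_n / 4^n ~ 1 / (√π
n^{3/2})`, and halving gives the claim. -/

/-! ### Weighted path sums on ℤ and their exchange symmetry -/

/-- The weight `x` of a row in the closed upper half plane, and `y` of one in the open lower half
plane. -/
def rowWeight {R : Type*} (x y : R) (h : ℤ) : R := if 0 ≤ h then x else y

/-- The sum over all `k`-step nearest neighbour paths on `ℤ` from `0` to `h` of the product of the
row weights of the vertices of the path, its last one excluded. -/
def pathSum {R : Type*} [CommRing R] (x y : R) : ℕ → ℤ → R
  | 0, h => if h = 0 then 1 else 0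
  | k + 1, h => rowWeight x y (h - 1) * pathSum x y k (h - 1) +
      rowWeight x y (h + 1) * pathSum x y k (h + 1)

/-- A linear functional that does not see the exchange of the two weights takes the same value at
the path sums with exchanged weights. -/
theorem map_pathSum_swap {R A : Type*} [CommRing R] [AddCommMonoid A] (L : R →+ A) (x y : R)
    (hL : ∀ a b : ℕ, L (x ^ a * y ^ b) = L (y ^ a * x ^ b)) (k : ℕ) (h : ℤ) :
    L (pathSum x y k h) = L (pathSum y x k h) := by
  -- The recursion peels one row weight at a time off the path sum, so the induction carries an
  -- arbitrary monomial; `hL` is its base case.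
  have key : ∀ (k : ℕ) (h : ℤ) (a b : ℕ),
      L (x ^ a * y ^ b * pathSum x y k h) = L (y ^ a * x ^ b * pathSum y x k h) := by
    intro k
    induction k with
    | zero =>
      intro h a b
      by_cases hh : h = 0 <;> simp [pathSum, hh, hL]
    | succ k ih =>
      have step : ∀ (h : ℤ) (a b : ℕ),
          L (x ^ a * y ^ b * (rowWeight x y h * pathSum x y k h)) =
            L (y ^ a * x ^ b * (rowWeight y x h * pathSum y x k h)) := by
        intro h a b
        unfold rowWeight
        split_ifs
        · convert ih h (a + 1) b using 2 <;> ring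
        · convert ih h a (b + 1) using 2 <;> ring
      intro h a b
      simp only [pathSum, mul_add, map_add, step]
  simpa using key k h 0 0

/-! ### Generating functions of bridges and a Chung-Feller formula -/

namespace PowerSeries

/-- The generating function of the paths on `ℤ` that reach `1` for the first time in their last
step. -/
noncomputable def firstPassage (R : Type*) [CommRing R] : PowerSeries R :=
  X * expand 2 two_ne_zero (map (Nat.castRingHom R) catalanSeries)

variable {R : Type*} [CommRing R]

theorem firstPassage_eq : firstPassage R = X * (1 + firstPassage R ^ 2) := by
  have h := congrArg (fun f => expand 2 two_ne_zero (map (Nat.castRingHom R) f))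
    catalanSeries_sq_mul_X_add_one
  simp only [map_add, map_mul, map_pow, map_one, map_X, expand_X] at h
  unfold firstPassage
  conv_lhs => rw [← h]
  ring

theorem coeff_firstPassage_succ (k : ℕ) :
    coeff (k + 1) (firstPassage R) = if 2 ∣ k then (catalan (k / 2) : R) else 0 := by
  rw [firstPassage, coeff_succ_X_mul, coeff_expand]
  simp

theorem coeff_firstPassage_zero : coeff 0 (firstPassage R) = 0 := by
  simp [firstPassage]

/-- The generating function of the first passage paths weighted by `x` per step. -/
noncomputable def weightedPassage (x : R) : PowerSeries R := rescale x (firstPassage R)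

theorem weightedPassage_eq (x : R) :
    weightedPassage x = C x * X * (1 + weightedPassage x ^ 2) := by
  have h := congrArg (rescale x) (firstPassage_eq (R := R))
  simp only [map_mul, map_add, map_one, map_pow, rescale_X] at h
  exact h

theorem constantCoeff_weightedPassage (x : R) : constantCoeff (weightedPassage x) = 0 := by
  rw [weightedPassage_eq]; simp

/-- The inverse of `1 - r * s` for the two passage generating functions `r` and `s`. -/
noncomputable def passageInv (x y : R) : PowerSeries R :=
  invOfUnit (1 - weightedPassage x * weightedPassage y) 1

theorem mul_passageInv (x y : R) :
    (1 - weightedPassage x * weightedPassage y) * passageInv x y = 1 :=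
  mul_invOfUnit _ _ (by simp [constantCoeff_weightedPassage])

theorem passageInv_comm (x y : R) : passageInv x y = passageInv y x := by
  rw [passageInv, passageInv, mul_comm]

/-- The generating function in the number of steps of `pathSum x y · h`. -/
noncomputable def pathSeries (x y : R) : ℤ → PowerSeries R
  | Int.ofNat n => (1 + weightedPassage x ^ 2) * weightedPassage x ^ n * passageInv x y
  | Int.negSucc n =>
    weightedPassage x * (1 + weightedPassage y ^ 2) * weightedPassage y ^ n * passageInv x y

/-- This is the last-step recursion. On each half line it has constant coefficients and is solved by
powers of `r` or `s`, since `r = xX(1 + r²)` and `s = yX(1 + s²)`; matching at the rows `0` and `-1`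
fixes the factors, with denominator `1 - rs`. -/
theorem pathSeries_eq (x y : R) (h : ℤ) :
    pathSeries x y h = (if h = 0 then 1 else 0) +
      X * (C (rowWeight x y (h - 1)) * pathSeries x y (h - 1) +
        C (rowWeight x y (h + 1)) * pathSeries x y (h + 1)) := by
  have hr := weightedPassage_eq x
  have hs := weightedPassage_eq y
  have hD := mul_passageInv x y
  have hp : ∀ n : ℕ, pathSeries x y (n : ℤ) =
      (1 + weightedPassage x ^ 2) * weightedPassage x ^ n * passageInv x y := fun n => rfl
  have hn : ∀ n : ℕ, pathSeries x y (-(n : ℤ) - 1) =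
      weightedPassage x * (1 + weightedPassage y ^ 2) * weightedPassage y ^ n *
        passageInv x y := fun n => by
    rw [show -(n : ℤ) - 1 = Int.negSucc n by omega]; rfl
  have wp : ∀ n : ℕ, rowWeight x y (n : ℤ) = x := fun n => by simp [rowWeight]
  have wn : ∀ n : ℕ, rowWeight x y (-(n : ℤ) - 1) = y := fun n => by
    rw [rowWeight, if_neg (by omega)]
  generalize weightedPassage x = r at *
  generalize weightedPassage y = s at *
  generalize passageInv x y = D at *
  rcases lt_trichotomy h 0 with h0 | h0 | h0
  · rw [if_neg h0.ne]
    obtain ⟨n, rfl⟩ : ∃ n : ℕ, h = -(n : ℤ) - 1 := ⟨(-h - 1).toNat, by omega⟩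
    rw [show -(n : ℤ) - 1 - 1 = -((n + 1 : ℕ) : ℤ) - 1 by push_cast; ring, hn, hn, wn]
    -- Row `-1` is special: its upper neighbour, row `0`, carries the other weight.
    rcases n with _ | n
    · rw [show -((0 : ℕ) : ℤ) - 1 + 1 = ((0 : ℕ) : ℤ) by norm_num, hp, wp]
      linear_combination D * hr + r * s * D * hs
    · rw [show -((n + 1 : ℕ) : ℤ) - 1 + 1 = -(n : ℤ) - 1 by push_cast; ring, hn, wn]
      linear_combination r * (1 + s ^ 2) * s ^ n * D * hs
  · subst h0
    rw [show (0 : ℤ) - 1 = -((0 : ℕ) : ℤ) - 1 by norm_num, hn, wn,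
      show (0 : ℤ) + 1 = ((1 : ℕ) : ℤ) by norm_num, hp, wp, if_pos rfl,
      show (0 : ℤ) = ((0 : ℕ) : ℤ) by norm_num, hp]
    linear_combination hD + r * D * hs + r * D * hr
  · rw [if_neg h0.ne']
    obtain ⟨n, rfl⟩ : ∃ n : ℕ, h = ((n + 1 : ℕ) : ℤ) := ⟨(h - 1).toNat, by omega⟩
    rw [show ((n + 1 : ℕ) : ℤ) - 1 = (n : ℤ) by push_cast; ring,
      show ((n + 1 : ℕ) : ℤ) + 1 = ((n + 2 : ℕ) : ℤ) by push_cast; ring, hp, hp, hp, wp, wp]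
    linear_combination (1 + r ^ 2) * r ^ n * D * hr

theorem coeff_pathSeries (x y : R) (k : ℕ) (h : ℤ) :
    coeff k (pathSeries x y h) = pathSum x y k h := by
  induction k generalizing h with
  | zero =>
    rw [pathSeries_eq]
    by_cases hh : h = 0 <;> simp [pathSum, hh]
  | succ k ih =>
    rw [pathSeries_eq, map_add, coeff_succ_X_mul, map_add, coeff_C_mul, coeff_C_mul, ih, ih,
      pathSum]
    have : coeff (k + 1) (if h = 0 then (1 : PowerSeries R) else 0) = 0 := by
      split_ifs <;> simp [coeff_one]
    rw [this, zero_add]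

/-- The generating function of the Chung-Feller counts: uniform distribution of the time spent in
the upper half plane. -/
noncomputable def uniformSeries (x y : R) : PowerSeries R :=
  mk fun k => (if 2 ∣ k then (catalan (k / 2) : R) else 0) *
    ∑ p ∈ Finset.HasAntidiagonal.antidiagonal k, x ^ p.1 * y ^ p.2

/-- Coefficientwise this is the factorization of `x^(k+1) - y^(k+1)`. -/
theorem mul_uniformSeries (x y : R) :
    X * (C x - C y) * uniformSeries x y = weightedPassage x - weightedPassage y := by
  ext k
  rcases k with _ | k
  · simp [constantCoeff_weightedPassage]
  · have hg := (Commute.all x y).geom_sum₂_mul (k + 1)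
    rw [mul_assoc, coeff_succ_X_mul, ← map_sub, coeff_C_mul, map_sub, weightedPassage,
      weightedPassage, coeff_rescale, coeff_rescale, coeff_firstPassage_succ, uniformSeries,
      coeff_mk, Finset.Nat.sum_antidiagonal_eq_sum_range_succ (fun i j => x ^ i * y ^ j),
      ← sub_mul, ← hg]
    simp only [Nat.succ_eq_add_one, Nat.add_sub_cancel]
    ring

variable [IsDomain R]

/-- Subtracting `s/(1+s²) = yX` from `r/(1+r²) = xX` gives `(r-s)(1-rs) = X(x-y)(1+r²)(1+s²)`; then
`X(x-y)` is cancelled. -/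
theorem uniformSeries_eq {x y : R} (hxy : x ≠ y) :
    uniformSeries x y =
      (1 + weightedPassage x ^ 2) * (1 + weightedPassage y ^ 2) * passageInv x y := by
  have hne : (X : PowerSeries R) * (C x - C y) ≠ 0 := by
    refine mul_ne_zero X_ne_zero ?_
    rw [sub_ne_zero]
    exact fun h => hxy (C_injective h)
  apply mul_left_cancel₀ hne
  rw [mul_uniformSeries]
  have hr := weightedPassage_eq x
  have hs := weightedPassage_eq y
  have hD := mul_passageInv x y
  generalize weightedPassage x = r at *
  generalize weightedPassage y = s at *
  generalize passageInv x y = D at *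
  linear_combination (-(r - s)) * hD + D * (1 + s ^ 2) * hr - D * (1 + r ^ 2) * hs

/-- The numerators satisfy `2 + r² + s² = (1+rs)(1-rs) + (1+r²)(1+s²)`. -/
theorem pathSeries_add_swap {x y : R} (hxy : x ≠ y) :
    pathSeries x y 0 + pathSeries y x 0 =
      1 + weightedPassage x * weightedPassage y + uniformSeries x y := by
  have hx : pathSeries x y 0 = (1 + weightedPassage x ^ 2) * weightedPassage x ^ 0 *
    passageInv x y := rfl
  have hy : pathSeries y x 0 = (1 + weightedPassage y ^ 2) * weightedPassage y ^ 0 *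
    passageInv y x := rfl
  rw [hx, hy, passageInv_comm y x, uniformSeries_eq hxy]
  have hD := mul_passageInv x y
  linear_combination (1 + weightedPassage x * weightedPassage y) * hD

/-- The symmetrized count of bridges by the time spent in the upper half plane. -/
theorem pathSum_add_swap {x y : R} (hxy : x ≠ y) {n : ℕ} (hn : n ≠ 0) :
    pathSum x y (2 * n) 0 + pathSum y x (2 * n) 0 =
      ∑ p ∈ Finset.HasAntidiagonal.antidiagonal (2 * n), (catalan n + coeff p.1 (firstPassage R) *
        coeff p.2 (firstPassage R)) * (x ^ p.1 * y ^ p.2) := by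
  rw [← coeff_pathSeries, ← coeff_pathSeries, ← map_add, pathSeries_add_swap hxy, map_add,
    map_add, coeff_one, if_neg (by omega), coeff_mul, uniformSeries, coeff_mk,
    if_pos (dvd_mul_right _ _), Nat.mul_div_cancel_left _ two_pos, Finset.mul_sum, zero_add,
    ← Finset.sum_add_distrib]
  refine Finset.sum_congr rfl fun p _ => ?_
  rw [weightedPassage, weightedPassage, coeff_rescale, coeff_rescale]
  ring

end PowerSeries

/-! ### The Markov property for events of the past -/

/-- The law of total probability along the values of a random element of a countable type. -/
theorem hasSum_measureReal_fiber {Ω V : Type*} [MeasurableSpace Ω] [MeasurableSpace V]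
    [Countable V] [MeasurableSingletonClass V] (P : Measure Ω) [IsFiniteMeasure P] {f : Ω → V}
    (hf : Measurable f) (B : Set Ω) :
    HasSum (fun v => P.real ({ω | f ω = v} ∩ B)) (P.real B) := by
  have h := tsum_measure_preimage_singleton (μ := P.restrict B) (f := f)
    (Set.countable_univ (α := V)) (fun y _ => hf (measurableSet_singleton y))
  rw [tsum_univ (fun v => P.restrict B (f ⁻¹' {v}))] at h
  have h' : ∑' v, P ({ω | f ω = v} ∩ B) = P B := by
    simp only [Measure.restrict_apply (hf (measurableSet_singleton _)), Set.preimage_univ,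
      Measure.restrict_apply_univ] at h
    exact h
  have hs := ENNReal.hasSum_toReal (f := fun v => P ({ω | f ω = v} ∩ B))
    (by rw [h']; finiteness)
  rwa [← ENNReal.tsum_toReal_eq fun _ => measure_ne_top _ _, h'] at hs

namespace IsSimpleRandomWalk

section General

variable {V Ω : Type*} [MeasurableSpace V] [MeasurableSpace Ω] [Countable V]
  [MeasurableSingletonClass V] {G : Digraph V} {x : V} {P : Measure Ω} [IsProbabilityMeasure P]
  {M : ℕ → Ω → V}

/-- The Markov property for events that depend on the trajectory up to time `n`. -/
theorem measureReal_and_step (hM : IsSimpleRandomWalk G x P M) {n : ℕ} {Q : (ℕ → V) → Prop}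
    (hQ : ∀ m m' : ℕ → V, (∀ i ≤ n, m i = m' i) → Q m → Q m') (v w : V) :
    P.real {ω | (Q (fun i => M i ω) ∧ M n ω = v) ∧ M (n + 1) ω = w} =
      P.real {ω | Q (fun i => M i ω) ∧ M n ω = v} * srwStep G v w := by
  have hf : Measurable fun ω (i : Fin (n + 1)) => M i ω :=
    measurable_pi_lambda _ fun i => hM.measurable i
  have h1 := hasSum_measureReal_fiber P hf
    {ω | (Q (fun i => M i ω) ∧ M n ω = v) ∧ M (n + 1) ω = w}
  have h2 := (hasSum_measureReal_fiber P hf {ω | Q (fun i => M i ω) ∧ M n ω = v}).mul_right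
    (srwStep G v w)
  refine h1.unique ?_
  refine (congrArg (fun f => HasSum f _) (funext fun p => ?_)).mpr h2
  -- Extending `p` by `w` makes the cylinder of `q` up to time `n + 1` include the final step to
  -- `w`.
  let q : ℕ → V := fun i => if h : i < n + 1 then p ⟨i, h⟩ else w
  have hq : ∀ ω, (fun i : Fin (n + 1) => M i ω) = p ↔ ∀ i ≤ n, M i ω = q i := by
    intro ω
    constructor
    · rintro rfl i hi
      simp only [q, dif_pos (Nat.lt_succ_of_le hi)]
    · intro h
      ext1 i
      rw [h i (Nat.lt_succ_iff.1 i.2)]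
      simp only [q, dif_pos i.2]
  by_cases hp : Q q ∧ q n = v
  · have e1 : {ω | (fun i : Fin (n + 1) => M i ω) = p} ∩
        {ω | (Q (fun i => M i ω) ∧ M n ω = v) ∧ M (n + 1) ω = w} =
        {ω | ∀ i ≤ n + 1, M i ω = q i} := by
      ext ω
      simp only [Set.mem_inter_iff, Set.mem_ofPred_eq, hq]
      constructor
      · rintro ⟨h, -, hw⟩ i hi
        rcases Nat.lt_or_eq_of_le hi with hi | rfl
        · exact h i (Nat.lt_succ_iff.1 hi)
        · simp [q, hw]
      · intro h
        refine ⟨fun i hi => h i (by omega), ⟨hQ q _ (fun i hi => (h i (by omega)).symm) hp.1, ?_⟩,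
          ?_⟩
        · rw [h n (by omega), hp.2]
        · rw [h _ le_rfl]; simp [q]
    have e2 : {ω | (fun i : Fin (n + 1) => M i ω) = p} ∩
        {ω | Q (fun i => M i ω) ∧ M n ω = v} = {ω | ∀ i ≤ n, M i ω = q i} := by
      ext ω
      simp only [Set.mem_inter_iff, Set.mem_ofPred_eq, hq]
      exact ⟨fun h => h.1, fun h => ⟨h, hQ q _ (fun i hi => (h i hi).symm) hp.1,
        by rw [h n le_rfl, hp.2]⟩⟩
    rw [e1, e2, hM.markov, hp.2]
    simp [q]
  · have e : ∀ ω, (∀ i ≤ n, M i ω = q i) → ¬ (Q (fun i => M i ω) ∧ M n ω = v) := by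
      intro ω h hh
      exact hp ⟨hQ _ q h hh.1, by rw [← h n le_rfl, hh.2]⟩
    have e1 : {ω | (fun i : Fin (n + 1) => M i ω) = p} ∩
        {ω | (Q (fun i => M i ω) ∧ M n ω = v) ∧ M (n + 1) ω = w} = ∅ := by
      ext ω
      simp only [Set.mem_inter_iff, Set.mem_ofPred_eq, hq, Set.mem_empty_iff_false, iff_false]
      exact fun h => e ω h.1 h.2.1
    have e2 : {ω | (fun i : Fin (n + 1) => M i ω) = p} ∩
        {ω | Q (fun i => M i ω) ∧ M n ω = v} = ∅ := by
      ext ω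
      simp only [Set.mem_inter_iff, Set.mem_ofPred_eq, hq, Set.mem_empty_iff_false, iff_false]
      exact fun h => e ω h.1 h.2
    rw [e1, e2]
    simp

theorem hasSum_step (hM : IsSimpleRandomWalk G x P M) {n : ℕ} {Q : (ℕ → V) → Prop}
    (hQ : ∀ m m' : ℕ → V, (∀ i ≤ n, m i = m' i) → Q m → Q m') (w : V) :
    HasSum (fun v => P.real {ω | Q (fun i => M i ω) ∧ M n ω = v} * srwStep G v w)
      (P.real {ω | Q (fun i => M i ω) ∧ M (n + 1) ω = w}) := by
  convert hasSum_measureReal_fiber P (hM.measurable n)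
    {ω | Q (fun i => M i ω) ∧ M (n + 1) ω = w} using 2 with v
  rw [← hM.measureReal_and_step hQ]
  congr 1
  ext ω
  simp only [Set.mem_ofPred_eq, Set.mem_inter_iff]
  tauto

end General

end IsSimpleRandomWalk

/-! ### Steps of the lattice and vertical times -/

/-- The direction of the horizontal edges of `latticeG1` in the row `h`. -/
def rowSign (h : ℤ) : ℤ := if 0 ≤ h then 1 else -1

theorem latticeG1_adj_iff (v w : ℤ × ℤ) :
    latticeG1.Adj v w ↔ w = (v.1, v.2 + 1) ∨ w = (v.1, v.2 - 1) ∨ w = (v.1 + rowSign v.2, v.2) := by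
  unfold latticeG1 rowSign
  split_ifs with h
  · simp [h, not_lt.2 h]
  · simp [h, sub_eq_add_neg, not_le.1 h]

theorem ncard_latticeG1_adj (v : ℤ × ℤ) : Set.ncard {u | latticeG1.Adj v u} = 3 := by
  rw [Set.ncard_eq_three]
  refine ⟨(v.1, v.2 + 1), (v.1, v.2 - 1), (v.1 + rowSign v.2, v.2), ?_, ?_, ?_, ?_⟩
  · simp only [ne_eq, Prod.mk.injEq, not_and]; omega
  · simp only [ne_eq, Prod.mk.injEq, not_and]; omega
  · simp only [ne_eq, Prod.mk.injEq, not_and]; omega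
  · ext u
    simp [latticeG1_adj_iff]

theorem latticeG1_adj_iff_mem (v : ℤ × ℤ) (z h : ℤ) :
    latticeG1.Adj v (z, h) ↔
      v ∈ ({(z, h - 1), (z, h + 1), (z - rowSign h, h)} : Finset (ℤ × ℤ)) := by
  obtain ⟨a, b⟩ := v
  simp only [latticeG1_adj_iff, Finset.mem_insert, Finset.mem_singleton, Prod.mk.injEq]
  refine or_congr (by omega) (or_congr (by omega) ⟨?_, ?_⟩)
  · rintro ⟨rfl, rfl⟩; simp
  · rintro ⟨rfl, rfl⟩; simp

theorem srwStep_latticeG1 (v : ℤ × ℤ) (z h : ℤ) :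
    srwStep latticeG1 v (z, h) =
      if v ∈ ({(z, h - 1), (z, h + 1), (z - rowSign h, h)} : Finset (ℤ × ℤ)) then 1 / 3
      else 0 := by
  rw [srwStep, ncard_latticeG1_adj]
  simp only [latticeG1_adj_iff_mem]
  norm_num

theorem verticalSteps_succ (m : ℕ → ℤ × ℤ) (t : ℕ) :
    verticalSteps m (t + 1) = verticalSteps m t + if (m (t + 1)).2 ≠ (m t).2 then 1 else 0 := by
  unfold verticalSteps
  rw [Finset.range_add_one, Finset.filter_insert]
  split_ifs
  · rw [Finset.card_insert_of_notMem (by simp)]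
  · rfl

theorem verticalSteps_zero (m : ℕ → ℤ × ℤ) : verticalSteps m 0 = 0 := rfl

theorem verticalSteps_congr {m m' : ℕ → ℤ × ℤ} {t : ℕ} (h : ∀ i ≤ t, m i = m' i) :
    verticalSteps m t = verticalSteps m' t := by
  unfold verticalSteps
  congr 1
  refine Finset.filter_congr fun i hi => ?_
  have := Finset.mem_range.1 hi
  rw [h i (by omega), h (i + 1) (by omega)]

theorem verticalSteps_mono (m : ℕ → ℤ × ℤ) : Monotone (verticalSteps m) :=
  monotone_nat_of_le_succ fun t => by rw [verticalSteps_succ]; omega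

theorem verticalTime_eq_iff (m : ℕ → ℤ × ℤ) (k t : ℕ) :
    verticalTime m k = (t : ℕ∞) ↔
      verticalSteps m t = k ∧ ∀ s < t, verticalSteps m s ≠ k := by
  constructor
  · intro h
    have hlow : ∀ s < t, verticalSteps m s ≠ k := by
      intro s hs hk
      have : verticalTime m k ≤ (s : ℕ∞) := iInf₂_le s hk
      rw [h] at this
      exact absurd (Nat.cast_le.1 this) (by omega)
    refine ⟨?_, hlow⟩
    by_contra hne
    have : ((t + 1 : ℕ) : ℕ∞) ≤ verticalTime m k := by
      refine le_iInf₂ fun s hs => Nat.cast_le.2 ?_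
      rcases lt_trichotomy s t with h1 | h1 | h1
      · exact absurd hs (hlow s h1)
      · exact absurd (h1 ▸ hs) hne
      · omega
    rw [h] at this
    exact absurd (Nat.cast_le.1 this) (by omega)
  · rintro ⟨h1, h2⟩
    refine le_antisymm (iInf₂_le t h1) (le_iInf₂ fun s hs => Nat.cast_le.2 ?_)
    by_contra hlt
    exact h2 s (by omega) hs

theorem verticalTime_succ_eq_succ_iff (m : ℕ → ℤ × ℤ) (k t : ℕ) :
    verticalTime m (k + 1) = ((t + 1 : ℕ) : ℕ∞) ↔
      verticalSteps m t = k ∧ (m (t + 1)).2 ≠ (m t).2 := by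
  rw [verticalTime_eq_iff, verticalSteps_succ]
  constructor
  · rintro ⟨h1, h2⟩
    have := h2 t (by omega)
    split_ifs at h1 with hv
    · exact ⟨by omega, hv⟩
    · omega
  · rintro ⟨h1, h2⟩
    refine ⟨by rw [if_pos h2, h1], fun s hs => ?_⟩
    have := verticalSteps_mono m (Nat.lt_succ_iff.1 hs)
    omega

theorem verticalTime_succ_ne_zero (m : ℕ → ℤ × ℤ) (k : ℕ) :
    verticalTime m (k + 1) ≠ ((0 : ℕ) : ℕ∞) := by
  rw [ne_eq, verticalTime_eq_iff, verticalSteps_zero]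
  omega

/-! ### Occupation probabilities jointly with the vertical step count -/

namespace IsSimpleRandomWalk

variable {Ω : Type*} [MeasurableSpace Ω] {P : Measure Ω} [IsProbabilityMeasure P]
  {M : ℕ → Ω → ℤ × ℤ}

theorem measureReal_latticeG1_step (hM : IsSimpleRandomWalk latticeG1 (0, 0) P M) {n : ℕ}
    {Q : (ℕ → ℤ × ℤ) → Prop} (hQ : ∀ m m', (∀ i ≤ n, m i = m' i) → Q m → Q m') (z h : ℤ) :
    P.real {ω | Q (fun i => M i ω) ∧ M (n + 1) ω = (z, h)} =
      1 / 3 * (P.real {ω | Q (fun i => M i ω) ∧ M n ω = (z, h - 1)} +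
        P.real {ω | Q (fun i => M i ω) ∧ M n ω = (z, h + 1)} +
        P.real {ω | Q (fun i => M i ω) ∧ M n ω = (z - rowSign h, h)}) := by
  have hs := hM.hasSum_step hQ (z, h)
  simp only [srwStep_latticeG1] at hs
  rw [hs.unique (hasSum_sum_of_ne_finset_zero
    (s := {(z, h - 1), (z, h + 1), (z - rowSign h, h)}) fun v hv => by rw [if_neg hv, mul_zero]),
    Finset.sum_congr rfl fun v hv => by rw [if_pos hv], Finset.sum_insert, Finset.sum_insert,
    Finset.sum_singleton]
  · ring
  · simp
  · simp only [Finset.mem_insert, Finset.mem_singleton, Prod.mk.injEq]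
    omega

/-- The probability that the walk is in `(z, h)` at time `t`, after `k` vertical steps. -/
noncomputable def occupation (P : Measure Ω) (M : ℕ → Ω → ℤ × ℤ) (t k : ℕ) (z h : ℤ) : ℝ :=
  P.real {ω | verticalSteps (fun i => M i ω) t = k ∧ M t ω = (z, h)}

theorem occupation_zero (hM : IsSimpleRandomWalk latticeG1 (0, 0) P M) (k : ℕ) (z h : ℤ) :
    occupation P M 0 k z h = if k = 0 ∧ z = 0 ∧ h = 0 then 1 else 0 := by
  rw [occupation]
  simp only [verticalSteps_zero]
  split_ifs with hc
  · obtain ⟨rfl, rfl, rfl⟩ := hc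
    rw [← probReal_univ (μ := P)]
    refine measureReal_congr ?_
    filter_upwards [hM.start] with ω hω
    exact eq_true ⟨rfl, hω⟩
  · rw [← measureReal_empty (μ := P)]
    refine measureReal_congr ?_
    filter_upwards [hM.start] with ω hω
    refine eq_false fun hh => hc ⟨hh.1.symm, ?_⟩
    have := hω.symm.trans hh.2
    simp only [Prod.mk.injEq] at this
    omega

theorem occupation_succ (hM : IsSimpleRandomWalk latticeG1 (0, 0) P M) (t k : ℕ) (z h : ℤ) :
    occupation P M (t + 1) k z h =
      1 / 3 * ((if k = 0 then 0 else occupation P M t (k - 1) z (h - 1)) +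
        (if k = 0 then 0 else occupation P M t (k - 1) z (h + 1)) +
        occupation P M t k (z - rowSign h) h) := by
  -- Once the walk is known to be in row `h` at time `t + 1`, the row at time `t` decides whether
  -- the last step was vertical, so the count becomes an event of the past.
  have key := hM.measureReal_latticeG1_step (n := t)
    (Q := fun m => (verticalSteps m t + if h ≠ (m t).2 then 1 else 0) = k) (by
      intro m m' hmm hm
      rw [← verticalSteps_congr hmm, ← hmm t le_rfl]
      exact hm) z h
  have e0 : {ω | verticalSteps (fun i => M i ω) (t + 1) = k ∧ M (t + 1) ω = (z, h)} =
      {ω | (verticalSteps (fun i => M i ω) t + if h ≠ (M t ω).2 then 1 else 0) = k ∧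
        M (t + 1) ω = (z, h)} := by
    ext ω
    simp only [Set.mem_ofPred_eq, verticalSteps_succ]
    refine and_congr_left fun hω => ?_
    rw [hω]
  have e1 : ∀ h', h' ≠ h →
      P.real {ω | (verticalSteps (fun i => M i ω) t + if h ≠ (M t ω).2 then 1 else 0) = k ∧
        M t ω = (z, h')} = if k = 0 then 0 else occupation P M t (k - 1) z h' := by
    intro h' hh'
    split_ifs with hk
    · convert measureReal_empty (μ := P)
      ext ω
      simp only [Set.mem_ofPred_eq, Set.mem_empty_iff_false, iff_false, not_and]
      intro h1 h2
      rw [h2, if_pos hh'.symm] at h1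
      omega
    · rw [occupation]
      congr 1
      ext ω
      simp only [Set.mem_ofPred_eq]
      refine and_congr_left fun h2 => ?_
      rw [h2, if_pos hh'.symm]
      omega
  have e2 : {ω | (verticalSteps (fun i => M i ω) t + if h ≠ (M t ω).2 then 1 else 0) = k ∧
        M t ω = (z - rowSign h, h)} =
      {ω | verticalSteps (fun i => M i ω) t = k ∧ M t ω = (z - rowSign h, h)} := by
    ext ω
    simp only [Set.mem_ofPred_eq]
    refine and_congr_left fun h2 => ?_
    rw [h2]
    simp
  have h0 : occupation P M (t + 1) k z h =
    P.real {ω | verticalSteps (fun i => M i ω) (t + 1) = k ∧ M (t + 1) ω = (z, h)} := rfl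
  rw [h0, e0, key, e1 _ (by omega), e1 _ (by omega), e2]
  rfl

/-- The witnesses `a` and `b` are the numbers of right and left steps. This makes the boundary terms
vanish when occupation probabilities are matched with coefficients. -/
theorem exists_of_occupation_ne_zero (hM : IsSimpleRandomWalk latticeG1 (0, 0) P M) (t : ℕ) :
    ∀ (k : ℕ) (z h : ℤ), occupation P M t k z h ≠ 0 →
      ∃ a b : ℕ, t = k + a + b ∧ z = (a : ℤ) - b := by
  induction t with
  | zero =>
    intro k z h hne
    rw [hM.occupation_zero] at hne
    have : k = 0 ∧ z = 0 ∧ h = 0 := by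
      by_contra hc
      exact hne (if_neg hc)
    exact ⟨0, 0, by omega, by simp [this]⟩
  | succ t ih =>
    intro k z h hne
    rw [hM.occupation_succ] at hne
    by_cases h3 : occupation P M t k (z - rowSign h) h = 0
    · rcases k with _ | k
      · simp [h3] at hne
      · have : occupation P M t k z (h - 1) ≠ 0 ∨ occupation P M t k z (h + 1) ≠ 0 := by
          by_contra! hc
          simp [hc, h3] at hne
        rcases this with h1 | h1 <;> obtain ⟨a, b, h4, h5⟩ := ih _ _ _ h1 <;>
          exact ⟨a, b, by omega, h5⟩
    · obtain ⟨a, b, h4, h5⟩ := ih _ _ _ h3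
      unfold rowSign at h5
      split_ifs at h5
      · exact ⟨a + 1, b, by omega, by push_cast; omega⟩
      · exact ⟨a, b + 1, by omega, by push_cast; omega⟩

end IsSimpleRandomWalk

/-! ### Geometric weights for the horizontal steps -/

namespace PowerSeries

/-- The generating function of the number of right steps made at one vertex of a path. -/
noncomputable def rightSeries : PowerSeries (PowerSeries ℝ) := C (mk 1)

/-- The generating function of the number of left steps made at one vertex of a path. -/
noncomputable def leftSeries : PowerSeries (PowerSeries ℝ) := mk 1

theorem rightSeries_eq : rightSeries = 1 + C X * rightSeries := by
  have h := congrArg (C (R := PowerSeries ℝ)) (mk_one_mul_one_sub_eq_one ℝ)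
  simp only [map_mul, map_sub, map_one] at h
  unfold rightSeries
  linear_combination h

theorem leftSeries_eq : leftSeries = 1 + X * leftSeries := by
  have h := mk_one_mul_one_sub_eq_one (PowerSeries ℝ)
  unfold leftSeries
  linear_combination h

theorem coeff_mk_one_pow (a j : ℕ) :
    coeff j ((mk 1 : PowerSeries (PowerSeries ℝ)) ^ a) = C (coeff j ((mk 1 : PowerSeries ℝ) ^ a)) := by
  have h : (mk 1 : PowerSeries (PowerSeries ℝ)) = map C (mk 1 : PowerSeries ℝ) := by
    ext1 n; simp
  rw [h, ← map_pow, coeff_map]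

/-- The number of ways to distribute `j` horizontal steps over `a` vertices. -/
noncomputable def distributions (a j : ℕ) : ℝ := coeff j ((mk 1 : PowerSeries ℝ) ^ a)

/-- The inner variable marks right steps and the outer one left steps, so the double coefficient
factors. -/
theorem coeff_rightSeries_pow_mul_leftSeries_pow (a b i j : ℕ) :
    coeff i (coeff j (rightSeries ^ a * leftSeries ^ b)) =
      distributions a i * distributions b j := by
  rw [distributions, distributions, rightSeries, leftSeries, ← map_pow, coeff_C_mul, coeff_mk_one_pow, mul_comm, coeff_C_mul,
    mul_comm]

theorem coeff_pathSum_swap (j k : ℕ) (h : ℤ) :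
    coeff j (coeff j (pathSum rightSeries leftSeries k h)) =
      coeff j (coeff j (pathSum leftSeries rightSeries k h)) := by
  refine map_pathSum_swap ((coeff (R := ℝ) j).toAddMonoidHom.comp
    (coeff (R := PowerSeries ℝ) j).toAddMonoidHom) rightSeries leftSeries (fun a b => ?_) k h
  have h := coeff_rightSeries_pow_mul_leftSeries_pow
  refine (h a b j j).trans (Eq.trans ?_ (h b a j j).symm |>.trans ?_)
  · ring
  · rw [mul_comm]; rfl

theorem rightSeries_ne_leftSeries : rightSeries ≠ leftSeries := by
  intro h
  have := congrArg (fun f => coeff 0 (coeff 1 f)) h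
  simp [rightSeries, leftSeries] at this

/-- The generating function, in the numbers of right and of left steps, of the paths of the walk
from the origin to the row `h` with `k` vertical steps. -/
noncomputable def walkSeries (k : ℕ) (h : ℤ) : PowerSeries (PowerSeries ℝ) :=
  rowWeight rightSeries leftSeries h * pathSum rightSeries leftSeries k h

/-- `pathSum` omits the weight of the last vertex: its term counts walks that have just arrived in
the row `h`, and the other term removes a final horizontal step. -/
theorem walkSeries_of_nonneg (k : ℕ) {h : ℤ} (hh : 0 ≤ h) :
    walkSeries k h = pathSum rightSeries leftSeries k h + C X * walkSeries k h := by
  rw [walkSeries, rowWeight, if_pos hh]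
  linear_combination pathSum rightSeries leftSeries k h * rightSeries_eq

theorem walkSeries_of_neg (k : ℕ) {h : ℤ} (hh : h < 0) :
    walkSeries k h = pathSum rightSeries leftSeries k h + X * walkSeries k h := by
  rw [walkSeries, rowWeight, if_neg (not_le.2 hh)]
  linear_combination pathSum rightSeries leftSeries k h * leftSeries_eq

theorem pathSum_eq_walkSeries (k : ℕ) (h : ℤ) :
    pathSum rightSeries leftSeries (k + 1) h = walkSeries k (h - 1) + walkSeries k (h + 1) := rfl

end PowerSeries

/-! ### The return probability as a sum of diagonal coefficients -/

open PowerSeries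

namespace IsSimpleRandomWalk

variable {Ω : Type*} [MeasurableSpace Ω] {P : Measure Ω} [IsProbabilityMeasure P]
  {M : ℕ → Ω → ℤ × ℤ}

theorem occupation_eq_zero (hM : IsSimpleRandomWalk latticeG1 (0, 0) P M) {t k : ℕ} {z : ℤ} (h : ℤ)
    (hne : ∀ a b : ℕ, t = k + a + b → z ≠ (a : ℤ) - b) : occupation P M t k z h = 0 := by
  by_contra hc
  obtain ⟨a, b, h1, h2⟩ := hM.exists_of_occupation_ne_zero t k z h hc
  exact hne a b h1 h2

theorem occupation_eq_coeff (hM : IsSimpleRandomWalk latticeG1 (0, 0) P M) (t : ℕ) :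
    ∀ (k a b : ℕ) (h : ℤ), t = k + a + b →
      occupation P M t k ((a : ℤ) - b) h = (1 / 3) ^ t * coeff a (coeff b (walkSeries k h)) := by
  induction t with
  | zero =>
    intro k a b h ht
    obtain ⟨rfl, rfl, rfl⟩ : k = 0 ∧ a = 0 ∧ b = 0 := by omega
    rw [hM.occupation_zero]
    by_cases hh : h = 0
    · subst hh
      rw [walkSeries_of_nonneg 0 le_rfl]
      simp [pathSum, mul_comm (C X)]
    · rw [walkSeries, pathSum, if_neg hh]
      simp [hh]
  | succ t ih =>
    intro k a b h ht
    have hvert : (if k = 0 then 0 else occupation P M t (k - 1) ((a : ℤ) - b) (h - 1)) +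
        (if k = 0 then 0 else occupation P M t (k - 1) ((a : ℤ) - b) (h + 1)) =
        (1 / 3) ^ t * coeff a (coeff b (pathSum rightSeries leftSeries k h)) := by
      rcases k with _ | k
      · have hab : coeff a (coeff b (pathSum rightSeries leftSeries 0 h)) = 0 := by
          rw [pathSum]
          split_ifs
          · rw [coeff_one]
            split_ifs with hb
            · rw [coeff_one, if_neg (by omega)]
            · simp
          · simp
        simp [hab]
      · rw [if_neg k.succ_ne_zero, if_neg k.succ_ne_zero, Nat.add_sub_cancel,
          ih k a b _ (by omega), ih k a b _ (by omega), pathSum_eq_walkSeries, map_add, map_add]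
        ring
    rw [hM.occupation_succ, hvert]
    rcases le_or_gt 0 h with hh | hh
    · rw [walkSeries_of_nonneg k hh, rowSign, if_pos hh, map_add, map_add, coeff_C_mul]
      rcases a with _ | a
      -- With `a = 0` a final right step is impossible: the position before it is out of reach in
      -- the `b` horizontal steps available.
      · rw [hM.occupation_eq_zero h (fun a' b' h1 h2 => by push_cast at h2; omega)]
        simp
        ring
      · rw [coeff_succ_X_mul, show ((a + 1 : ℕ) : ℤ) - b - 1 = (a : ℤ) - b by push_cast; ring,
          ih k a b h (by omega)]
        ring
    · rw [walkSeries_of_neg k hh, rowSign, if_neg (not_le.2 hh), map_add, map_add]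
      rcases b with _ | b
      · rw [hM.occupation_eq_zero h (fun a' b' h1 h2 => by push_cast at h2; omega)]
        simp
        ring
      · rw [coeff_succ_X_mul, show (a : ℤ) - ((b + 1 : ℕ) : ℤ) - -1 = (a : ℤ) - b by push_cast; ring,
          ih k a b h (by omega)]
        ring

theorem measureReal_verticalTime_succ (hM : IsSimpleRandomWalk latticeG1 (0, 0) P M) (k t : ℕ) :
    P.real {ω | verticalTime (fun i => M i ω) (k + 1) = ((t + 1 : ℕ) : ℕ∞) ∧ M (t + 1) ω = (0, 0)} =
      1 / 3 * (occupation P M t k 0 (-1) + occupation P M t k 0 1) := by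
  -- Requiring a row other than `0` at time `t` encodes that the step into the origin is vertical,
  -- and rules out the horizontal predecessor.
  have key := hM.measureReal_latticeG1_step (n := t)
    (Q := fun m => verticalSteps m t = k ∧ (m t).2 ≠ 0) (by
      intro m m' hmm hm
      rw [← verticalSteps_congr hmm, ← hmm t le_rfl]
      exact hm) 0 0
  have e0 : {ω | verticalTime (fun i => M i ω) (k + 1) = ((t + 1 : ℕ) : ℕ∞) ∧
      M (t + 1) ω = (0, 0)} =
      {ω | (verticalSteps (fun i => M i ω) t = k ∧ (M t ω).2 ≠ 0) ∧ M (t + 1) ω = (0, 0)} := by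
    ext ω
    simp only [Set.mem_ofPred_eq, verticalTime_succ_eq_succ_iff]
    refine and_congr_left fun h => ?_
    rw [h, ne_comm]
  have e1 : ∀ h : ℤ, h ≠ 0 →
      P.real {ω | (verticalSteps (fun i => M i ω) t = k ∧ (M t ω).2 ≠ 0) ∧ M t ω = (0, h)} =
        occupation P M t k 0 h := by
    intro h hh
    rw [occupation]
    congr 1
    ext ω
    simp only [Set.mem_ofPred_eq]
    refine and_congr_left fun h1 => ?_
    rw [h1]
    simp [hh]
  have e2 : {ω | (verticalSteps (fun i => M i ω) t = k ∧ (M t ω).2 ≠ 0) ∧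
      M t ω = (0 - rowSign 0, 0)} = ∅ := by
    ext ω
    simp only [Set.mem_ofPred_eq, Set.mem_empty_iff_false, iff_false]
    rintro ⟨⟨-, h1⟩, h2⟩
    rw [h2] at h1
    exact h1 rfl
  rw [e0, key, e1 _ (by norm_num), e1 _ (by norm_num), e2]
  simp

theorem hasSum_measureReal_verticalTime (hM : IsSimpleRandomWalk latticeG1 (0, 0) P M) (k : ℕ)
    (v : ℤ × ℤ) :
    HasSum (fun t : ℕ => P.real {ω | verticalTime (fun i => M i ω) k = (t : ℕ∞) ∧ M t ω = v})
      (P.real {ω | ∃ t : ℕ, verticalTime (fun i => M i ω) k = (t : ℕ∞) ∧ M t ω = v}) := by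
  set E : ℕ → Set Ω := fun t =>
    {ω | verticalTime (fun i => M i ω) k = (t : ℕ∞) ∧ M t ω = v} with hE
  have hmeas : ∀ t, MeasurableSet (E t) := by
    intro t
    have hf : Measurable fun ω (i : Fin (t + 1)) => M i ω :=
      measurable_pi_lambda _ fun i => hM.measurable i
    convert hf ((Set.to_countable {p : Fin (t + 1) → ℤ × ℤ |
      verticalTime (fun i => if h : i < t + 1 then p ⟨i, h⟩ else 0) k = (t : ℕ∞) ∧
        p (Fin.last t) = v}).measurableSet) using 1
    ext ω
    have hc : ∀ s ≤ t, verticalSteps (fun i => M i ω) s =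
        verticalSteps (fun i => if h : i < t + 1 then M i ω else 0) s := fun s hs =>
      verticalSteps_congr fun i hi => by rw [dif_pos (by omega)]
    simp only [hE, Set.mem_ofPred_eq, Set.mem_preimage, verticalTime_eq_iff, Fin.val_last]
    rw [hc t le_rfl]
    refine and_congr_left fun _ => and_congr_right fun _ => forall₂_congr fun s hs => ?_
    rw [hc s hs.le]
  have hdisj : Pairwise (Function.onFun Disjoint E) := by
    intro s t hst
    refine Set.disjoint_left.2 fun ω h1 h2 => hst ?_
    exact_mod_cast h1.1.symm.trans h2.1
  have hU : {ω | ∃ t : ℕ, verticalTime (fun i => M i ω) k = (t : ℕ∞) ∧ M t ω = v} =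
      ⋃ t, E t := by
    ext ω; simp [hE]
  have h := measure_iUnion (μ := P) hdisj hmeas
  have hs := ENNReal.hasSum_toReal (f := fun t => P (E t)) (by rw [← h]; finiteness)
  rw [← ENNReal.tsum_toReal_eq fun _ => measure_ne_top _ _, ← h] at hs
  rw [hU]
  exact hs

theorem measureReal_verticalTime_add_two_mul (hM : IsSimpleRandomWalk latticeG1 (0, 0) P M)
    (k j : ℕ) :
    P.real {ω | verticalTime (fun i => M i ω) (k + 1) = ((k + 1 + 2 * j : ℕ) : ℕ∞) ∧
      M (k + 1 + 2 * j) ω = (0, 0)} = (1 / 3 : ℝ) ^ (k + 1 + 2 * j) *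
      coeff j (coeff j (pathSum rightSeries leftSeries (k + 1) 0)) := by
  have h2 : ∀ h, occupation P M (k + 2 * j) k 0 h =
      (1 / 3) ^ (k + 2 * j) * coeff j (coeff j (walkSeries k h)) := fun h => by
    rw [← hM.occupation_eq_coeff (k + 2 * j) k j j h (by omega), sub_self]
  rw [show k + 1 + 2 * j = k + 2 * j + 1 by ring, hM.measureReal_verticalTime_succ, h2, h2,
    pathSum_eq_walkSeries, map_add, map_add, zero_sub, zero_add, pow_succ]
  ring

theorem measureReal_verticalTime_eq_zero (hM : IsSimpleRandomWalk latticeG1 (0, 0) P M)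
    {k t : ℕ} (ht : ∀ j, t ≠ k + 1 + 2 * j) :
    P.real {ω | verticalTime (fun i => M i ω) (k + 1) = (t : ℕ∞) ∧ M t ω = (0, 0)} = 0 := by
  rcases t with _ | t
  · convert measureReal_empty (μ := P)
    ext ω
    simp only [Set.mem_ofPred_eq, Set.mem_empty_iff_false, iff_false]
    exact fun h => verticalTime_succ_ne_zero _ _ h.1
  · have hz : ∀ h, occupation P M t k 0 h = 0 := fun h =>
      hM.occupation_eq_zero h fun a b h1 h2 => ht a (by omega)
    rw [hM.measureReal_verticalTime_succ, hz, hz]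
    simp

/-- The return probability at the time of an even vertical step, as a sum over the number `j` of
right steps, which is also the number of left steps. -/
theorem hasSum_return (hM : IsSimpleRandomWalk latticeG1 (0, 0) P M) {n : ℕ} (hn : n ≠ 0) :
    HasSum (fun j : ℕ => (1 / 3 : ℝ) ^ (2 * n + 2 * j) *
        coeff j (coeff j (pathSum rightSeries leftSeries (2 * n) 0)))
      (P.real {ω | ∃ t : ℕ, verticalTime (fun i => M i ω) (2 * n) = (t : ℕ∞) ∧ M t ω = (0, 0)}) := by
  obtain ⟨k, hk⟩ : ∃ k, 2 * n = k + 1 := ⟨2 * n - 1, by omega⟩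
  rw [hk]
  -- Only times with `2j` horizontal steps, `j` in each direction, contribute.
  have hinj : Function.Injective fun j => k + 1 + 2 * j := fun i j hij => by
    simpa using hij
  refine (congrArg (fun f => HasSum f _) (funext fun j => ?_)).mpr
    ((hinj.hasSum_iff fun t ht => ?_).2 (hM.hasSum_measureReal_verticalTime (k + 1) (0, 0)))
  · exact (hM.measureReal_verticalTime_add_two_mul k j).symm
  · exact hM.measureReal_verticalTime_eq_zero fun j hj => ht ⟨j, hj.symm⟩

/-- The distribution of the time in the upper half plane enters only through its symmetrization. -/
theorem hasSum_two_mul_return (hM : IsSimpleRandomWalk latticeG1 (0, 0) P M) {n : ℕ} (hn : n ≠ 0) :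
    HasSum (fun j : ℕ => (1 / 3 : ℝ) ^ (2 * n + 2 * j) *
        ∑ p ∈ Finset.HasAntidiagonal.antidiagonal (2 * n),
          (catalan n + coeff p.1 (firstPassage ℝ) * coeff p.2 (firstPassage ℝ)) *
          (distributions p.1 j * distributions p.2 j))
      (2 * P.real {ω | ∃ t : ℕ,
        verticalTime (fun i => M i ω) (2 * n) = (t : ℕ∞) ∧ M t ω = (0, 0)}) := by
  have h := (hM.hasSum_return hn).mul_left 2
  refine (congrArg (fun f => HasSum f _) (funext fun j => ?_)).mpr h
  have hsum := congrArg (fun f => coeff j (coeff j f))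
    (pathSum_add_swap rightSeries_ne_leftSeries hn)
  simp only [map_add, map_sum, ← coeff_pathSum_swap] at hsum
  have hcoe : ∀ i, coeff i (firstPassage (PowerSeries (PowerSeries ℝ))) =
      C (C (coeff i (firstPassage ℝ))) := by
    intro i
    rcases i with _ | i
    · simp [coeff_firstPassage_zero, -coeff_zero_eq_constantCoeff]
    · rw [coeff_firstPassage_succ, coeff_firstPassage_succ]
      split_ifs <;> simp
  have hterm : ∀ p : ℕ × ℕ, coeff j (coeff j (((catalan n : PowerSeries (PowerSeries ℝ)) +
      coeff p.1 (firstPassage (PowerSeries (PowerSeries ℝ))) *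
        coeff p.2 (firstPassage (PowerSeries (PowerSeries ℝ)))) *
      (rightSeries ^ p.1 * leftSeries ^ p.2))) =
      (catalan n + coeff p.1 (firstPassage ℝ) * coeff p.2 (firstPassage ℝ)) *
        (distributions p.1 j * distributions p.2 j) := by
    intro p
    rw [hcoe, hcoe, show (catalan n : PowerSeries (PowerSeries ℝ)) = C (C (catalan n : ℝ)) by simp,
      ← map_mul, ← map_mul, ← map_add, ← map_add, coeff_C_mul, coeff_C_mul,
      coeff_rightSeries_pow_mul_leftSeries_pow]
  simp only [hterm] at hsum
  rw [← hsum]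
  ring

end IsSimpleRandomWalk

/-! ### Balance probabilities: exact sum and tail bounds -/

open Topology

namespace PowerSeries

theorem distributions_zero (j : ℕ) : distributions 0 j = if j = 0 then 1 else 0 := by
  rw [distributions, pow_zero, coeff_one]

theorem distributions_succ (a j : ℕ) : distributions (a + 1) j = (j + a).choose a := by
  rw [distributions, mk_one_pow_eq_mk_choose_add, coeff_mk, add_comm]

theorem distributions_nonneg (a j : ℕ) : 0 ≤ distributions a j := by
  rcases a with _ | a
  · rw [distributions_zero]; split_ifs <;> norm_num
  · rw [distributions_succ]; positivity

theorem distributions_succ_comm (a j : ℕ) : distributions (a + 1) j = distributions (j + 1) a := by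
  rw [distributions_succ, distributions_succ, ← Nat.choose_symm_add, add_comm j a]

/-- Exchanging the two arguments by `distributions_succ_comm` turns the sum into the Cauchy product
of two powers of the geometric series. -/
theorem sum_antidiagonal_distributions (j N : ℕ) :
    ∑ p ∈ Finset.HasAntidiagonal.antidiagonal N,
      distributions (p.1 + 1) j * distributions (p.2 + 1) j = distributions (N + 1) (2 * j + 1) := by
  have h : distributions (2 * j + 1 + 1) N = ∑ p ∈ Finset.HasAntidiagonal.antidiagonal N,
      distributions (j + 1) p.1 * distributions (j + 1) p.2 := by
    simp only [distributions]
    rw [show 2 * j + 1 + 1 = (j + 1) + (j + 1) by ring, pow_add, coeff_mul]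
  rw [distributions_succ_comm, h]
  exact Finset.sum_congr rfl fun p _ => by
    rw [distributions_succ_comm, distributions_succ_comm p.2]

theorem hasSum_distributions (a : ℕ) {s : ℝ} (hs : |s| < 1) :
    HasSum (fun j => distributions a j * s ^ j) (((1 - s) ^ a)⁻¹) := by
  rcases a with _ | a
  · have h := hasSum_single (f := fun j => distributions 0 j * s ^ j) 0 fun j hj => by
      rw [distributions_zero, if_neg hj, zero_mul]
    simpa [distributions_zero] using h
  · have h := hasSum_choose_mul_geometric_of_norm_lt_one (𝕜 := ℝ) a hs
    simpa only [distributions_succ, one_div] using h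

theorem hasSum_distributions_odd (a : ℕ) {s : ℝ} (hs : |s| < 1) :
    HasSum (fun j => distributions a (2 * j + 1) * s ^ (2 * j + 1))
      ((((1 - s) ^ a)⁻¹ - ((1 + s) ^ a)⁻¹) / 2) := by
  have h := ((hasSum_distributions a hs).sub
    (hasSum_distributions a (s := -s) (by rwa [abs_neg]))).div_const 2
  rw [sub_neg_eq_add] at h
  have hinj : Function.Injective fun j : ℕ => 2 * j + 1 := fun i j hij => by simpa using hij
  refine (congrArg (fun f => HasSum f _) (funext fun j => ?_)).mpr
    ((hinj.hasSum_iff fun t ht => ?_).2 h)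
  · simp only [Function.comp, (odd_two_mul_add_one j).neg_pow]
    ring
  · have ht : Even t := by
      rw [← Nat.not_odd_iff_even]
      rintro ⟨j, hj⟩
      exact ht ⟨j, hj.symm⟩
    rw [ht.neg_pow]
    ring

/-- The probability that as many horizontal steps are made at `a` vertices as at `b` others. -/
noncomputable def balance (a b : ℕ) : ℝ :=
  (2 / 3) ^ (a + b) * ∑' j, (1 / 9) ^ j * (distributions a j * distributions b j)

theorem distributions_mul_le (a j : ℕ) : distributions a j * (2 / 3) ^ j ≤ 3 ^ a := by
  have h := hasSum_distributions a (s := 2 / 3) (by norm_num [abs_lt])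
  have := le_hasSum h j fun i _ => mul_nonneg (distributions_nonneg a i) (by positivity)
  refine this.trans (le_of_eq ?_)
  rw [← inv_pow]
  norm_num

theorem balance_term_le (a b j : ℕ) :
    (1 / 9 : ℝ) ^ j * (distributions a j * distributions b j) ≤
      3 ^ a * (distributions b j * (1 / 6) ^ j) := by
  have h := distributions_mul_le a j
  have hb : 0 ≤ distributions b j * (1 / 6) ^ j :=
    mul_nonneg (distributions_nonneg b j) (by positivity)
  calc (1 / 9 : ℝ) ^ j * (distributions a j * distributions b j)
      = (distributions a j * (2 / 3) ^ j) * (distributions b j * (1 / 6) ^ j) := by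
        -- The split of `1/9` is deliberately uneven: after normalization each of the `b` vertices
        -- gains `2/3 · 6/5 = 4/5`, and each of the `a` vertices costs `2/3 · 3 = 2`.
        rw [show (1 / 9 : ℝ) = 2 / 3 * (1 / 6) by norm_num, mul_pow]; ring
    _ ≤ _ := mul_le_mul_of_nonneg_right h hb

theorem balance_term_nonneg (a b j : ℕ) :
    0 ≤ (1 / 9 : ℝ) ^ j * (distributions a j * distributions b j) :=
  mul_nonneg (by positivity) (mul_nonneg (distributions_nonneg a j) (distributions_nonneg b j))

theorem summable_balance (a b : ℕ) :
    Summable fun j => (1 / 9 : ℝ) ^ j * (distributions a j * distributions b j) :=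
  Summable.of_nonneg_of_le (balance_term_nonneg a b) (balance_term_le a b)
    ((hasSum_distributions b (s := 1 / 6) (by norm_num [abs_lt])).summable.mul_left _)

theorem balance_nonneg (a b : ℕ) : 0 ≤ balance a b :=
  mul_nonneg (by positivity) (tsum_nonneg (balance_term_nonneg a b))

theorem balance_comm (a b : ℕ) : balance a b = balance b a := by
  simp only [balance, add_comm a b, mul_comm (distributions a _)]

/-- A Chernoff bound. -/
theorem balance_le (a b : ℕ) : balance a b ≤ 2 ^ a * (4 / 5) ^ b := by
  have h := (hasSum_distributions b (s := 1 / 6) (by norm_num [abs_lt])).mul_left ((3 : ℝ) ^ a)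
  have h1 := (summable_balance a b).tsum_le_tsum (balance_term_le a b) h.summable
  rw [h.tsum_eq] at h1
  calc balance a b ≤ (2 / 3) ^ (a + b) * (3 ^ a * ((1 - 1 / 6) ^ b)⁻¹) :=
        mul_le_mul_of_nonneg_left h1 (by positivity)
    _ = (2 / 3 * 3) ^ a * (2 / 3 * (1 - 1 / 6)⁻¹) ^ b := by
        rw [pow_add, mul_pow, mul_pow, inv_pow]; ring
    _ = _ := by norm_num

theorem balance_zero_left (b : ℕ) : balance 0 b = (2 / 3) ^ b := by
  rw [balance, tsum_eq_single 0 fun j hj => by rw [distributions_zero, if_neg hj]; ring]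
  rcases b with _ | b
  · simp [distributions_zero]
  · simp [distributions_zero, distributions_succ]

/-- The end terms `a = 0` and `b = 0` give `2(2/3)^(2n)`. The others add up to the odd part of a
negative binomial series at `1/3`, whose two halves contribute `1` and `-(1/2)^(2n-1)`. -/
theorem sum_balance {n : ℕ} (hn : n ≠ 0) :
    ∑ p ∈ Finset.HasAntidiagonal.antidiagonal (2 * n), balance p.1 p.2 =
      1 - (1 / 2) ^ (2 * n - 1) + 2 * (2 / 3) ^ (2 * n) := by
  obtain ⟨N, hN⟩ : ∃ N, 2 * n = N + 2 := ⟨2 * n - 2, by omega⟩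
  rw [hN, Finset.Nat.sum_antidiagonal_succ, Finset.Nat.sum_antidiagonal_succ', balance_zero_left,
    balance_comm (N + 1 + 1), balance_zero_left]
  have h1 : ∑ p ∈ Finset.HasAntidiagonal.antidiagonal N, balance (p.1 + 1) (p.2 + 1) =
      (2 / 3) ^ (N + 2) * ∑' j, 3 * (distributions (N + 1) (2 * j + 1) * (1 / 3) ^ (2 * j + 1)) := by
    have h2 : ∀ j, 3 * (distributions (N + 1) (2 * j + 1) * (1 / 3) ^ (2 * j + 1)) =
        ∑ p ∈ Finset.HasAntidiagonal.antidiagonal N,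
          (1 / 9 : ℝ) ^ j * (distributions (p.1 + 1) j * distributions (p.2 + 1) j) := by
      intro j
      rw [← Finset.mul_sum, sum_antidiagonal_distributions, pow_succ, pow_mul]
      norm_num
      ring
    simp only [h2]
    rw [Summable.tsum_finsetSum fun p _ => summable_balance _ _, Finset.mul_sum]
    refine Finset.sum_congr rfl fun p hp => ?_
    rw [balance, ← Finset.HasAntidiagonal.mem_antidiagonal.1 hp]
    ring_nf
  have h3 := (hasSum_distributions_odd (N + 1) (s := 1 / 3) (by norm_num [abs_lt])).mul_left 3
  have e1 : (2 / 3 : ℝ) ^ (N + 1) * ((1 - 1 / 3) ^ (N + 1))⁻¹ = 1 := by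
    rw [← inv_pow, ← mul_pow]; norm_num
  have e2 : (2 / 3 : ℝ) ^ (N + 1) * ((1 + 1 / 3) ^ (N + 1))⁻¹ = (1 / 2) ^ (N + 1) := by
    rw [← inv_pow, ← mul_pow]; norm_num
  rw [h1, h3.tsum_eq, show N + 2 - 1 = N + 1 by omega]
  have e3 : (2 / 3 : ℝ) ^ (N + 2) = 2 / 3 * (2 / 3) ^ (N + 1) := pow_succ' _ _
  rw [e3]
  linear_combination e1 - e2

theorem tendsto_sum_balance :
    Tendsto (fun n : ℕ => ∑ p ∈ Finset.HasAntidiagonal.antidiagonal (2 * n), balance p.1 p.2)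
      atTop (𝓝 1) := by
  have h1 : Tendsto (fun n : ℕ => 2 * n - 1) atTop atTop :=
    tendsto_atTop_mono (fun n => by omega) (tendsto_sub_atTop_nat 1)
  have h2 : Tendsto (fun n : ℕ => 2 * n) atTop atTop :=
    tendsto_atTop_mono (fun n => show n ≤ 2 * n by omega) tendsto_id
  have h3 := (tendsto_pow_atTop_nhds_zero_of_lt_one (r := (1 / 2 : ℝ)) (by norm_num)
    (by norm_num)).comp h1
  have h4 := (tendsto_pow_atTop_nhds_zero_of_lt_one (r := (2 / 3 : ℝ)) (by norm_num)
    (by norm_num)).comp h2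
  have h := (h3.const_sub 1).add (h4.const_mul 2)
  simp only [sub_zero, mul_zero, add_zero] at h
  refine h.congr' ?_
  filter_upwards [eventually_ne_atTop 0] with n hn
  rw [sum_balance hn]
  rfl

theorem firstPassage_coeff_nonneg (i : ℕ) : 0 ≤ coeff i (firstPassage ℝ) := by
  rcases i with _ | i
  · rw [coeff_firstPassage_zero]
  · rw [coeff_firstPassage_succ]; split_ifs <;> positivity

theorem firstPassage_coeff_le (i : ℕ) : coeff i (firstPassage ℝ) ≤ 2 ^ i / (i + 1) := by
  rcases i with _ | i
  · rw [coeff_firstPassage_zero]; positivity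
  · rw [coeff_firstPassage_succ]
    split_ifs with h
    · obtain ⟨m, rfl⟩ := h
      rw [Nat.mul_div_cancel_left _ two_pos, le_div_iff₀ (by positivity)]
      have h1 : ((m + 1) * catalan m : ℝ) ≤ 4 ^ m := by
        exact_mod_cast (succ_mul_catalan_eq_centralBinom m).trans_le (Nat.centralBinom_le_four_pow m)
      push_cast
      rw [pow_succ, pow_mul]
      norm_num
      linarith
    · positivity

theorem balance_div_le {n : ℕ} (hn : n ≠ 0) {a b : ℕ} (hab : a + b = 2 * n) :
    balance a b / ((a + 1) * (b + 1)) ≤ 16 / n ^ 2 * balance a b + (81 / 100) ^ n := by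
  have hn' : (0 : ℝ) < n := by positivity
  have hB := balance_nonneg a b
  have edge : ∀ a b : ℕ, a + b = 2 * n → 4 * a < n → balance a b ≤ (81 / 100) ^ n := by
    intro a b hab ha
    calc balance a b ≤ 2 ^ a * (4 / 5) ^ b := balance_le a b
      _ = (2 * (5 / 4)) ^ a * ((4 / 5) ^ a * (4 / 5) ^ b) := by
          have : (5 / 4 : ℝ) ^ a * (4 / 5) ^ a = 1 := by rw [← mul_pow]; norm_num
          rw [mul_pow]
          linear_combination (-(2 ^ a * (4 / 5) ^ b : ℝ)) * this
      _ = (5 / 2) ^ a * (16 / 25) ^ n := by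
          rw [← pow_add, hab, pow_mul]; norm_num
      -- The constants work because `5/2 ≤ 1.26⁴`, `4a < n` and `1.26 · 0.64 ≤ 0.81`.
      _ ≤ ((126 / 100) ^ 4) ^ a * (16 / 25) ^ n := by
          gcongr; norm_num
      _ = (126 / 100) ^ (4 * a) * (16 / 25) ^ n := by rw [pow_mul]
      _ ≤ (126 / 100) ^ n * (16 / 25) ^ n := by
          gcongr; norm_num
      _ = (126 / 100 * (16 / 25)) ^ n := by rw [mul_pow]
      _ ≤ (81 / 100) ^ n := by gcongr; norm_num
  have hdiv : balance a b / ((a + 1) * (b + 1)) ≤ balance a b := by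
    refine div_le_self hB ?_
    have : (0 : ℝ) ≤ a := by positivity
    have : (0 : ℝ) ≤ b := by positivity
    nlinarith
  have hpos : 0 ≤ 16 / (n : ℝ) ^ 2 * balance a b := by positivity
  rcases lt_or_ge (4 * a) n with ha | ha
  · linarith [edge a b hab ha]
  rcases lt_or_ge (4 * b) n with hb | hb
  · have := edge b a (by omega) hb
    rw [balance_comm] at this
    linarith
  -- In the bulk both `a` and `b` are at least `n/4`, whence the factor `16/n²`.
  · have ha' : (n : ℝ) ≤ 4 * a := by exact_mod_cast ha
    have hb' : (n : ℝ) ≤ 4 * b := by exact_mod_cast hb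
    have : balance a b / ((a + 1) * (b + 1)) ≤ 16 / n ^ 2 * balance a b := by
      rw [div_eq_mul_inv, mul_comm]
      refine mul_le_mul_of_nonneg_right ?_ hB
      rw [inv_eq_one_div, div_le_div_iff₀ (by positivity) (by positivity)]
      nlinarith
    have : (0 : ℝ) ≤ (81 / 100) ^ n := by positivity
    linarith

/-- The contribution of the paths with an odd number of vertices in each half plane that is not
uniform in this number. -/
noncomputable def oddCorrection (n : ℕ) : ℝ :=
  ∑ p ∈ Finset.HasAntidiagonal.antidiagonal (2 * n),
    coeff p.1 (firstPassage ℝ) * coeff p.2 (firstPassage ℝ) / 4 ^ n * balance p.1 p.2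

theorem oddCorrection_nonneg (n : ℕ) : 0 ≤ oddCorrection n :=
  Finset.sum_nonneg fun p _ => mul_nonneg (div_nonneg (mul_nonneg (firstPassage_coeff_nonneg _)
    (firstPassage_coeff_nonneg _)) (by positivity)) (balance_nonneg _ _)

theorem oddCorrection_le {n : ℕ} (hn : n ≠ 0) :
    oddCorrection n ≤ 16 / n ^ 2 * ∑ p ∈ Finset.HasAntidiagonal.antidiagonal (2 * n),
      balance p.1 p.2 + (2 * n + 1) * (81 / 100) ^ n := by
  have h : oddCorrection n ≤ ∑ p ∈ Finset.HasAntidiagonal.antidiagonal (2 * n),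
      (16 / n ^ 2 * balance p.1 p.2 + (81 / 100) ^ n) := by
    refine Finset.sum_le_sum fun p hp => ?_
    have hp := Finset.HasAntidiagonal.mem_antidiagonal.1 hp
    refine le_trans ?_ (balance_div_le hn hp)
    rw [div_eq_inv_mul (balance p.1 p.2)]
    refine mul_le_mul_of_nonneg_right ?_ (balance_nonneg _ _)
    rw [div_le_iff₀ (by positivity)]
    refine (mul_le_mul (firstPassage_coeff_le p.1) (firstPassage_coeff_le p.2)
      (firstPassage_coeff_nonneg _) (by positivity)).trans (le_of_eq ?_)
    rw [show (4 : ℝ) ^ n = 2 ^ p.1 * 2 ^ p.2 by rw [← pow_add, hp, pow_mul]; norm_num,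
      div_mul_div_comm, inv_mul_eq_div]
  refine h.trans (le_of_eq ?_)
  rw [Finset.sum_add_distrib, ← Finset.mul_sum, Finset.sum_const, Finset.Nat.card_antidiagonal,
    nsmul_eq_mul]
  push_cast
  ring

theorem tendsto_oddCorrection :
    Tendsto (fun n : ℕ => (n : ℝ) ^ (3 / 2 : ℝ) * oddCorrection n) atTop (𝓝 0) := by
  have h1 : Tendsto (fun n : ℕ => (n : ℝ) ^ (-(1 / 2) : ℝ)) atTop (𝓝 0) :=
    (tendsto_rpow_neg_atTop (by norm_num)).comp tendsto_natCast_atTop_atTop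
  have h2 : Tendsto (fun n : ℕ => (n : ℝ) ^ 3 * (81 / 100) ^ n) atTop (𝓝 0) :=
    tendsto_pow_const_mul_const_pow_of_abs_lt_one 3 (by norm_num [abs_lt])
  have h := ((h1.const_mul 16).mul tendsto_sum_balance).add (h2.const_mul 3)
  simp only [mul_zero, zero_mul, add_zero] at h
  refine squeeze_zero' (Eventually.of_forall fun n => mul_nonneg (by positivity)
    (oddCorrection_nonneg n)) ?_ h
  filter_upwards [eventually_ne_atTop 0] with n hn
  have hn' : (0 : ℝ) < n := by positivity
  have hn1 : (1 : ℝ) ≤ n := by exact_mod_cast Nat.one_le_iff_ne_zero.2 hn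
  have e : (n : ℝ) ^ (3 / 2 : ℝ) = n ^ (-(1 / 2) : ℝ) * n ^ 2 := by
    rw [← Real.rpow_natCast, ← Real.rpow_add hn']; norm_num
  have e2 : (n : ℝ) ^ (3 / 2 : ℝ) * (2 * n + 1) ≤ 3 * n ^ 3 := by
    have : (n : ℝ) ^ (3 / 2 : ℝ) ≤ n ^ 2 := by
      rw [← Real.rpow_natCast]
      exact Real.rpow_le_rpow_of_exponent_le hn1 (by norm_num)
    nlinarith [sq_nonneg (n : ℝ)]
  calc (n : ℝ) ^ (3 / 2 : ℝ) * oddCorrection n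
      ≤ (n : ℝ) ^ (3 / 2 : ℝ) * _ := mul_le_mul_of_nonneg_left (oddCorrection_le hn) (by positivity)
    _ = 16 * n ^ (-(1 / 2) : ℝ) * ∑ p ∈ Finset.HasAntidiagonal.antidiagonal (2 * n),
          balance p.1 p.2 + (n : ℝ) ^ (3 / 2 : ℝ) * (2 * n + 1) * (81 / 100) ^ n := by
        rw [mul_add, e]
        field_simp
    _ ≤ _ := by
        have := mul_le_mul_of_nonneg_right e2 (by positivity : (0 : ℝ) ≤ (81 / 100) ^ n)
        linarith

end PowerSeries

/-! ### Stirling asymptotics and conclusion -/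

theorem tendsto_centralBinom_div :
    Tendsto (fun n : ℕ => (n : ℝ) ^ (1 / 2 : ℝ) * (n.centralBinom / 4 ^ n)) atTop
      (𝓝 (1 / √Real.pi)) := by
  have h := Stirling.tendsto_stirlingSeq_sqrt_pi
  have h2 : Tendsto (fun n : ℕ => 2 * n) atTop atTop :=
    tendsto_atTop_mono (fun n => show n ≤ 2 * n by omega) tendsto_id
  have hpi : √Real.pi ≠ 0 := by positivity
  -- The quotient of the Stirling sequence at `2n` by its square at `n` is exactly `√n` times the
  -- central binomial coefficient over `4^n`.
  have hl := (h.comp h2).div (h.pow 2) (by positivity)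
  rw [show √Real.pi / √Real.pi ^ 2 = 1 / √Real.pi by field_simp] at hl
  refine hl.congr' ?_
  filter_upwards [eventually_ne_atTop 0] with n hn
  have hn' : (0 : ℝ) < n := by positivity
  have hc : (n.centralBinom : ℝ) * (n.factorial * n.factorial) = (2 * n).factorial := by
    have := Nat.choose_mul_factorial_mul_factorial (show n ≤ 2 * n by omega)
    rw [← Nat.centralBinom_eq_two_mul_choose, show 2 * n - n = n by omega, mul_assoc] at this
    exact_mod_cast this
  have hsq : √(2 * (n : ℝ)) ^ 2 = 2 * n := Real.sq_sqrt (by positivity)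
  have hsq2 : √(2 * ((2 * n : ℕ) : ℝ)) = 2 * √n := by
    rw [show (2 * ((2 * n : ℕ) : ℝ)) = 2 ^ 2 * n by push_cast; ring, Real.sqrt_mul (by positivity),
      Real.sqrt_sq (by norm_num)]
  have hs : √(n : ℝ) ^ 2 = n := Real.sq_sqrt hn'.le
  have hf : (n.factorial : ℝ) ≠ 0 := by positivity
  have hs0 : √(n : ℝ) ≠ 0 := by positivity
  have hq : (((2 * n : ℕ) : ℝ) / Real.exp 1) ^ (2 * n) = 4 ^ n * ((n / Real.exp 1) ^ n) ^ 2 := by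
    rw [← pow_mul, mul_comm n 2, pow_mul, pow_mul, ← mul_pow]
    push_cast
    ring
  have hq0 : ((n : ℝ) / Real.exp 1) ^ n ≠ 0 := by positivity
  simp only [Pi.div_apply, Function.comp, Stirling.stirlingSeq]
  rw [← hc, ← Real.sqrt_eq_rpow, hsq2, hq]
  generalize ((n : ℝ) / Real.exp 1) ^ n = q at *
  rw [div_pow, mul_pow, hsq]
  field_simp
  rw [hs]

namespace IsSimpleRandomWalk

open PowerSeries

variable {Ω : Type*} [MeasurableSpace Ω] {P : Measure Ω} [IsProbabilityMeasure P]
  {M : ℕ → Ω → ℤ × ℤ}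

/-- Writing `(1/3)^(2n)` as `4^(-n) (2/3)^(2n)` separates the probability of a vertical path from
the geometric laws in `balance`. -/
theorem two_mul_return_eq (hM : IsSimpleRandomWalk latticeG1 (0, 0) P M) {n : ℕ} (hn : n ≠ 0) :
    2 * P.real {ω | ∃ t : ℕ,
        verticalTime (fun i => M i ω) (2 * n) = (t : ℕ∞) ∧ M t ω = (0, 0)} =
      catalan n / 4 ^ n * ∑ p ∈ Finset.HasAntidiagonal.antidiagonal (2 * n), balance p.1 p.2 +
        oddCorrection n := by
  rw [← (hM.hasSum_two_mul_return hn).tsum_eq]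
  have h1 : ∀ j : ℕ, (1 / 3 : ℝ) ^ (2 * n + 2 * j) *
        ∑ p ∈ Finset.HasAntidiagonal.antidiagonal (2 * n),
          (catalan n + coeff p.1 (firstPassage ℝ) * coeff p.2 (firstPassage ℝ)) *
          (distributions p.1 j * distributions p.2 j) =
      ∑ p ∈ Finset.HasAntidiagonal.antidiagonal (2 * n), (1 / 3 : ℝ) ^ (2 * n) *
        (catalan n + coeff p.1 (firstPassage ℝ) * coeff p.2 (firstPassage ℝ)) *
          ((1 / 9 : ℝ) ^ j * (distributions p.1 j * distributions p.2 j)) := by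
    intro j
    rw [Finset.mul_sum]
    refine Finset.sum_congr rfl fun p _ => ?_
    rw [pow_add, pow_mul _ 2 j]
    norm_num
    ring
  simp only [h1]
  rw [Summable.tsum_finsetSum fun p _ => (summable_balance _ _).mul_left _, oddCorrection,
    Finset.mul_sum, ← Finset.sum_add_distrib]
  refine Finset.sum_congr rfl fun p hp => ?_
  rw [tsum_mul_left, balance, Finset.HasAntidiagonal.mem_antidiagonal.1 hp,
    show (1 / 3 : ℝ) ^ (2 * n) = (2 / 3) ^ (2 * n) / 4 ^ n by
      rw [pow_mul, pow_mul, ← div_pow]; norm_num]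
  ring

end IsSimpleRandomWalk

theorem tendsto_catalan_div :
    Tendsto (fun n : ℕ => (n : ℝ) ^ (3 / 2 : ℝ) * (catalan n / 4 ^ n)) atTop
      (𝓝 (1 / √Real.pi)) := by
  have h := tendsto_centralBinom_div.mul (tendsto_natCast_div_add_atTop (1 : ℝ))
  rw [mul_one] at h
  refine h.congr' ?_
  filter_upwards [eventually_ne_atTop 0] with n hn
  have hn' : (0 : ℝ) < n := by positivity
  have hc : (n.centralBinom : ℝ) = (n + 1) * catalan n := by
    exact_mod_cast (succ_mul_catalan_eq_centralBinom n).symm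
  have e : (n : ℝ) ^ (3 / 2 : ℝ) = n ^ (1 / 2 : ℝ) * n := by
    rw [← Real.rpow_add_one hn'.ne']; norm_num
  rw [hc, e]
  field_simp

theorem theorem3 {Ω : Type*} [MeasurableSpace Ω] (P : Measure Ω) [IsProbabilityMeasure P]
    (M : ℕ → Ω → ℤ × ℤ) (hM : IsSimpleRandomWalk latticeG1 (0, 0) P M) :
    (fun n : ℕ => P.real {ω | ∃ t : ℕ,
        verticalTime (fun i => M i ω) (2 * n) = (t : ℕ∞) ∧ M t ω = (0, 0)})
      ~[atTop] (fun n : ℕ => 1 / (2 * Real.sqrt Real.pi * (n : ℝ) ^ (3 / 2 : ℝ))) := by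
  have hpi : √Real.pi ≠ 0 := by positivity
  have h := ((tendsto_catalan_div.mul PowerSeries.tendsto_sum_balance).add
    PowerSeries.tendsto_oddCorrection).mul_const √Real.pi
  rw [mul_one, add_zero, one_div, inv_mul_cancel₀ hpi] at h
  refine isEquivalent_of_tendsto_one (h.congr' ?_)
  filter_upwards [eventually_ne_atTop 0] with n hn
  have hn' : (0 : ℝ) < n := by positivity
  have key := hM.two_mul_return_eq hn
  rw [mul_assoc ((n : ℝ) ^ (3 / 2 : ℝ)), ← mul_add, ← key]
  simp only [Pi.div_apply]
  field_simp
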